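/- Let $t_0\in\mathbb R$ and let $a_{11},a_{12},a_{21},a_{22}$ be real-valued continuous functions on $[t_0,+\infty)$. Consider the system $$\phi'=a_{11}(t)\phi+a_{12}(t)\psi,\qquad \psi'=a_{21}(t)\phi+a_{22}(t)\psi,\qquad t\ge t_0, \tag{1.1}$$ and its real-valued solutions on $[t_0,+\infty)$. Put $B=a_{11}-a_{22}$, $S=a_{11}+a_{22}$, $J_S(t)=\exp\{\int_{t_0}^t S(s)\,ds\}$. All integrals up to $+\infty$ are improper integrals. Suppose that $a_{12}(t)\ge 0$ and $a_{21}(t)\le 0$ for $t\ge t_0$, that $a_{12}$ and $a_{21}$ have unbounded supports, and that $$I^+_{a_{12},B}(t_0)=\int_{t_0}^{+\infty}a_{12}(\tau)\exp\Bigl\{-\int_{t_0}^{\tau}B(s)\,ds\Bigr\}d\tau<+\infty,\qquad I^+_{-a_{21},-B}(t_0)=\int_{t_0}^{+\infty}\bigl(-a_{21}(\tau)\bigr)\exp\Bigl\{\int_{t_0}^{\tau}B(s)\,ds\Bigr\}d\tau<+\infty .$$ Then: A) The system (1.1) is non-oscillatory: for each nontrivial solution $(\phi,\psi)$ neither $\phi$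 nor $\psi$ has arbitrarily large zeroes. B) There exist linearly independent nontrivial solutions $(\phi_*,\psi_0)$ and $(\phi_0,\psi_*)$ of (1.1) such that: 1. for each solution $(\phi,\psi)$ linearly independent of $(\phi_*,\psi_0)$ (respectively, of $(\phi_0,\psi_*)$), $\phi$ (respectively $\psi$) is nonzero for all large $t$ and $$\lim_{t\to+\infty}\frac{\phi_*(t)}{\phi(t)}=0\qquad\Bigl(\text{respectively } \lim_{t\to+\infty}\frac{\psi_*(t)}{\psi(t)}=0\Bigr); \tag{3.80}$$ and each of the two is, up to a nonzero constant multiplier, the only nontrivial solution of (1.1) with its property; 2. for some $T>t_0$ one has $\phi_*(t)>0$, $\psi_0(t)<0$, $\phi_0(t)>0$, $\psi_*(t)>0$ for all $t\ge T$, and $$\int_T^{+\infty}\frac{a_{12}(\tau)J_S(\tau)}{\phi_*^2(\tau)}d\tau=-\int_T^{+\infty}\frac{a_{21}(\tau)J_S(\tau)}{\psi_*^2(\tau)}d\tau=+\infty, \tag{3.81}$$ $$\int_T^{+\infty}a_{12}(\tau)\frac{\psi_0(\tau)}{\phi_*(\tau)}d\tau=-\infty,\qquad \int_T^{+\infty}a_{21}(\tau)\frac{\phi_0(\tau)}{\psi_*(\tau)}d\tau=-\infty;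 \tag{3.83}$$ 3. for each solution $(\phi,\psi)$ linearly independent of $(\phi_*,\psi_0)$ (respectively, of $(\phi_0,\psi_*)$) and each $T_1\ge t_0$ such that $\phi(t)\ne0$ and $\psi(t)\ne0$ for all $t\ge T_1$, $$\int_{T_1}^{+\infty}\frac{a_{12}(\tau)J_S(\tau)}{\phi^2(\tau)}d\tau<+\infty\qquad\Bigl(\text{respectively } \int_{T_1}^{+\infty}\frac{|a_{21}(\tau)|J_S(\tau)}{\psi^2(\tau)}d\tau<+\infty\Bigr), \tag{3.82}$$ and the integral $\int_{T_1}^{+\infty}a_{12}(\tau)\frac{\psi(\tau)}{\phi(\tau)}d\tau$ (respectively $\int_{T_1}^{+\infty}a_{21}(\tau)\frac{\phi(\tau)}{\psi(\tau)}d\tau$) converges. -/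

import Mathlib

open Set Filter Topology MeasureTheory

noncomputable section

/-- The pair `(φ, ψ)` solves on `[t₀, ∞)` the system
`φ' = a₁₁ φ + a₁₂ ψ`, `ψ' = a₂₁ φ + a₂₂ ψ` (with the one-sided derivative at `t₀`).
The values of all functions to the left of `t₀` are irrelevant. -/
def IsSolution (t₀ : ℝ) (a₁₁ a₁₂ a₂₁ a₂₂ φ ψ : ℝ → ℝ) : Prop :=
  ∀ t, t₀ ≤ t →
    HasDerivWithinAt φ (a₁₁ t * φ t + a₁₂ t * ψ t) (Ici t₀) t ∧
    HasDerivWithinAt ψ (a₂₁ t * φ t + a₂₂ t * ψ t) (Ici t₀) t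

/-- The pair `(φ, ψ)` is not identically zero on `[t₀, ∞)`. -/
def NontrivialPair (t₀ : ℝ) (φ ψ : ℝ → ℝ) : Prop :=
  ∃ t, t₀ ≤ t ∧ (φ t ≠ 0 ∨ ψ t ≠ 0)

/-- Linear independence over `ℝ` of two pairs, as vector functions on `[t₀, ∞)`. -/
def LinIndepPairs (t₀ : ℝ) (φ₁ ψ₁ φ₂ ψ₂ : ℝ → ℝ) : Prop :=
  ∀ c₁ c₂ : ℝ,
    (∀ t, t₀ ≤ t → c₁ * φ₁ t + c₂ * φ₂ t = 0 ∧ c₁ * ψ₁ t + c₂ * ψ₂ t = 0) →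
    c₁ = 0 ∧ c₂ = 0

/-- A function on `[t₀, ∞)` is oscillatory if it has arbitrarily large zeroes. -/
def Oscillatory (t₀ : ℝ) (u : ℝ → ℝ) : Prop :=
  ∀ T, t₀ ≤ T → ∃ t, T ≤ t ∧ u t = 0

/-- The system is non-oscillatory: both components of each nontrivial solution are
non-oscillatory. -/
def NonOscillatorySystem (t₀ : ℝ) (a₁₁ a₁₂ a₂₁ a₂₂ : ℝ → ℝ) : Prop :=
  ∀ φ ψ : ℝ → ℝ, IsSolution t₀ a₁₁ a₁₂ a₂₁ a₂₂ φ ψ → NontrivialPair t₀ φ ψ →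
    ¬ Oscillatory t₀ φ ∧ ¬ Oscillatory t₀ ψ

/-- `J_u(t₁; t) = exp (∫_{t₁}^t u)`. -/
def JExp (u : ℝ → ℝ) (t₁ t : ℝ) : ℝ :=
  Real.exp (∫ τ in t₁..t, u τ)

/-- `I⁺_{u,v}(t₁; t) = ∫_{t₁}^t u(τ) J_{-v}(t₁; τ) dτ`. -/
def IPlus (u v : ℝ → ℝ) (t₁ t : ℝ) : ℝ :=
  ∫ τ in t₁..t, u τ * JExp (fun s => - v s) t₁ τ

/-- The improper integral `∫_T^∞ f` converges to a finite number. -/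
def ImproperConverges (f : ℝ → ℝ) (T : ℝ) : Prop :=
  ∃ L : ℝ, Tendsto (fun t => ∫ τ in T..t, f τ) atTop (𝓝 L)

/-- The improper integral `∫_T^∞ f` is `+∞`. -/
def ImproperEqTop (f : ℝ → ℝ) (T : ℝ) : Prop :=
  Tendsto (fun t => ∫ τ in T..t, f τ) atTop atTop

/-- The improper integral `∫_T^∞ f` is `-∞`. -/
def ImproperEqBot (f : ℝ → ℝ) (T : ℝ) : Prop :=
  Tendsto (fun t => ∫ τ in T..t, f τ) atTop atBot

/-- `(φ, ψ)` is a nontrivial solution which is minimal with respect to the first component: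
for every solution `(φ', ψ')` linearly independent of it, `φ'` is eventually nonzero and
`φ / φ' → 0`. -/
def IsMinimalFst (t₀ : ℝ) (a₁₁ a₁₂ a₂₁ a₂₂ φ ψ : ℝ → ℝ) : Prop :=
  IsSolution t₀ a₁₁ a₁₂ a₂₁ a₂₂ φ ψ ∧ NontrivialPair t₀ φ ψ ∧
  ∀ φ' ψ' : ℝ → ℝ, IsSolution t₀ a₁₁ a₁₂ a₂₁ a₂₂ φ' ψ' → LinIndepPairs t₀ φ ψ φ' ψ' →
    (∀ᶠ t in atTop, φ' t ≠ 0) ∧ Tendsto (fun t => φ t / φ' t) atTop (𝓝 0)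

/-- `(φ, ψ)` is a nontrivial solution which is minimal with respect to the second component:
for every solution `(φ', ψ')` linearly independent of it, `ψ'` is eventually nonzero and
`ψ / ψ' → 0`. -/
def IsMinimalSnd (t₀ : ℝ) (a₁₁ a₁₂ a₂₁ a₂₂ φ ψ : ℝ → ℝ) : Prop :=
  IsSolution t₀ a₁₁ a₁₂ a₂₁ a₂₂ φ ψ ∧ NontrivialPair t₀ φ ψ ∧
  ∀ φ' ψ' : ℝ → ℝ, IsSolution t₀ a₁₁ a₁₂ a₂₁ a₂₂ φ' ψ' → LinIndepPairs t₀ φ ψ φ' ψ' →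
    (∀ᶠ t in atTop, ψ' t ≠ 0) ∧ Tendsto (fun t => ψ t / ψ' t) atTop (𝓝 0)

end

open scoped BoundedContinuousFunction

/-! Dividing `φ` and `ψ` by the exponentials of the integrals of `a₁₁` and `a₂₂` removes the
diagonal: the quotients satisfy `u' = p v`, `v' = -q u`, where `p, q ≥ 0` are exactly the integrands
of the two hypotheses, hence integrable.

For such a system every solution has finite limits `(b, c)` at infinity, and a solution is
determined by them, because the logarithmic derivative of `u² + v²` is at most `p + q` in absolute
value (`exists_tendsto`, `eq_zero_of_tendsto_zero`). Every pair of limits occurs, by a contraction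
argument in a weighted space (`exists_isOffDiagSolution_tendsto`).

The solution minimal in the first component is the one with limits `(0, -1)`. Any independent
solution has `b ≠ 0`, so the ratio tends to `0`. The integrals are read off from `(log u)' = p v /
u` and `(1/u)' = -p v / u²`. Unbounded support of `p` keeps `u` from vanishing eventually when `b =
0` (`eventually_signs`). The second component follows from the quarter turn `(φ, ψ) ↦ (ψ, -φ)`,
which exchanges `p` and `q`. -/

/-! ### Calculus on a closed half-line. -/

lemma continuous_comp_max {f : ℝ → ℝ} {a : ℝ} (hf : ContinuousOn f (Ici a)) :
    Continuous fun t => f (max a t) :=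
  hf.comp_continuous (continuous_const.max continuous_id) fun t => le_max_left a t

lemma intervalIntegrable_of_continuousOn_Ici {f : ℝ → ℝ} {a b c : ℝ}
    (hf : ContinuousOn f (Ici a)) (hb : a ≤ b) (hc : a ≤ c) :
    IntervalIntegrable f volume b c :=
  (hf.mono fun _ hx => (le_inf hb hc).trans hx.1).intervalIntegrable

lemma hasDerivWithinAt_integral_Ici {f : ℝ → ℝ} {a t : ℝ} (hf : ContinuousOn f (Ici a))
    (ht : a ≤ t) : HasDerivWithinAt (fun t => ∫ τ in a..t, f τ) (f t) (Ici a) t := by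
  -- Extending `f` to the left of `a` by the constant `f a` makes the two-sided theorem available at
  -- `t = a` as well.
  have h := (intervalIntegral.integral_hasDerivAt_right
    ((continuous_comp_max hf).intervalIntegrable a t)
    (continuous_comp_max hf).stronglyMeasurable.stronglyMeasurableAtFilter
    (continuous_comp_max hf).continuousAt).hasDerivWithinAt (s := Ici a)
  rw [max_eq_right ht] at h
  have key : ∀ s ∈ Ici a, (∫ τ in a..s, f τ) = ∫ τ in a..s, f (max a τ) := by
    intro s hs
    refine intervalIntegral.integral_congr fun τ hτ => ?_
    rw [uIcc_of_le hs] at hτ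
    simp [max_eq_right hτ.1]
  exact h.congr key (key t ht)

lemma integral_eq_sub_of_hasDerivWithinAt_Ici {f f' : ℝ → ℝ} {a b c : ℝ}
    (hf : ∀ t, a ≤ t → HasDerivWithinAt f (f' t) (Ici a) t) (hf' : ContinuousOn f' (Ici a))
    (hb : a ≤ b) (hc : b ≤ c) : ∫ τ in b..c, f' τ = f c - f b := by
  refine intervalIntegral.integral_eq_sub_of_hasDeriv_right_of_le hc
    (fun t ht => ((hf t (hb.trans ht.1)).continuousWithinAt).mono
      fun s hs => hb.trans hs.1) (fun t ht => (hf t (hb.trans ht.1.le)).mono ?_)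
    (intervalIntegrable_of_continuousOn_Ici hf' hb (hb.trans hc))
  exact fun s hs => (hb.trans ht.1.le).trans (le_of_lt hs)

lemma hasDerivWithinAt_integral_Ioi {f : ℝ → ℝ} {a t : ℝ} (hf : ContinuousOn f (Ici a))
    (hi : IntegrableOn f (Ioi a)) (ht : a ≤ t) :
    HasDerivWithinAt (fun t => ∫ τ in Ioi t, f τ) (-f t) (Ici a) t := by
  have key : ∀ s ∈ Ici a, (∫ τ in Ioi s, f τ) = (∫ τ in Ioi a, f τ) - ∫ τ in a..s, f τ := by
    intro s hs
    rw [← intervalIntegral.integral_Ioi_sub_Ioi hi hs]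
    ring
  exact ((hasDerivWithinAt_integral_Ici hf ht).const_sub _).congr key (key t ht)

lemma tendsto_integral_Ioi_atTop {f : ℝ → ℝ} {a : ℝ} (hi : IntegrableOn f (Ioi a)) :
    Tendsto (fun t => ∫ τ in Ioi t, f τ) atTop (𝓝 0) := by
  have h := (intervalIntegral_tendsto_integral_Ioi a hi tendsto_id).const_sub (∫ τ in Ioi a, f τ)
  rw [sub_self] at h
  refine h.congr' ?_
  filter_upwards [eventually_ge_atTop a] with t ht
  rw [id, ← intervalIntegral.integral_Ioi_sub_Ioi hi ht]
  ring

lemma monotoneOn_Ici_of_hasDerivWithinAt {f f' : ℝ → ℝ} {a : ℝ}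
    (hf : ∀ t, a ≤ t → HasDerivWithinAt f (f' t) (Ici a) t) (h : ∀ t, a ≤ t → 0 ≤ f' t) :
    MonotoneOn f (Ici a) := by
  refine monotoneOn_of_hasDerivWithinAt_nonneg (f' := f') (convex_Ici a)
    (fun t ht => (hf t ht).continuousWithinAt) ?_ ?_
  · intro t ht
    rw [interior_Ici] at ht ⊢
    exact (hf t (le_of_lt ht)).mono Ioi_subset_Ici_self
  · intro t ht
    rw [interior_Ici] at ht
    exact h t (le_of_lt ht)

lemma antitoneOn_Ici_of_hasDerivWithinAt {f f' : ℝ → ℝ} {a : ℝ}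
    (hf : ∀ t, a ≤ t → HasDerivWithinAt f (f' t) (Ici a) t) (h : ∀ t, a ≤ t → f' t ≤ 0) :
    AntitoneOn f (Ici a) := by
  have := monotoneOn_Ici_of_hasDerivWithinAt (f := fun t => -f t) (f' := fun t => -f' t)
    (fun t ht => (hf t ht).neg) (fun t ht => neg_nonneg.2 (h t ht))
  exact fun x hx y hy hxy => neg_le_neg_iff.1 (this hx hy hxy)

/-! ### Exponential factors. -/

lemma JExp_pos (u : ℝ → ℝ) (a t : ℝ) : 0 < JExp u a t := Real.exp_pos _

lemma hasDerivWithinAt_JExp {u : ℝ → ℝ} {a t : ℝ} (hu : ContinuousOn u (Ici a)) (ht : a ≤ t) :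
    HasDerivWithinAt (JExp u a) (u t * JExp u a t) (Ici a) t := by
  have := (hasDerivWithinAt_integral_Ici hu ht).exp
  rw [mul_comm] at this
  exact this

lemma continuousOn_JExp {u : ℝ → ℝ} {a : ℝ} (hu : ContinuousOn u (Ici a)) :
    ContinuousOn (JExp u a) (Ici a) :=
  fun _ ht => (hasDerivWithinAt_JExp hu ht).continuousWithinAt

lemma JExp_add {u v : ℝ → ℝ} {a t : ℝ} (hu : ContinuousOn u (Ici a))
    (hv : ContinuousOn v (Ici a)) (ht : a ≤ t) :
    JExp (fun s => u s + v s) a t = JExp u a t * JExp v a t := by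
  rw [JExp, intervalIntegral.integral_add (intervalIntegrable_of_continuousOn_Ici hu le_rfl ht)
    (intervalIntegrable_of_continuousOn_Ici hv le_rfl ht), Real.exp_add]
  rfl

lemma JExp_neg (u : ℝ → ℝ) (a t : ℝ) : JExp (fun s => -u s) a t = (JExp u a t)⁻¹ := by
  simp only [JExp, intervalIntegral.integral_neg, Real.exp_neg]

/-! ### Off-diagonal systems with nonnegative integrable coefficients: bounds, limits, signs. -/

/-- `(u, v)` solves `u' = p v`, `v' = -q u` on `[a, ∞)`. -/
def IsOffDiagSolution (a : ℝ) (p q u v : ℝ → ℝ) : Prop :=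
  ∀ t, a ≤ t → HasDerivWithinAt u (p t * v t) (Ici a) t ∧
    HasDerivWithinAt v (-(q t * u t)) (Ici a) t

namespace IsOffDiagSolution

variable {a : ℝ} {p q u v : ℝ → ℝ}

lemma continuousOn_fst (h : IsOffDiagSolution a p q u v) : ContinuousOn u (Ici a) :=
  fun t ht => (h t ht).1.continuousWithinAt

lemma continuousOn_snd (h : IsOffDiagSolution a p q u v) : ContinuousOn v (Ici a) :=
  fun t ht => (h t ht).2.continuousWithinAt

/-- The quarter turn exchanges the roles of `p` and `q`, so only first components need to be
studied. -/
lemma swap (h : IsOffDiagSolution a p q u v) : IsOffDiagSolution a q p v (fun t => -u t) := by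
  intro t ht
  exact ⟨(h t ht).2.congr_deriv (by ring), (h t ht).1.neg⟩

lemma linear_comb {u' v' : ℝ → ℝ} (h : IsOffDiagSolution a p q u v)
    (h' : IsOffDiagSolution a p q u' v') (c c' : ℝ) :
    IsOffDiagSolution a p q (fun t => c * u t + c' * u' t) (fun t => c * v t + c' * v' t) := by
  intro t ht
  constructor
  · exact (((h t ht).1.const_mul c).add ((h' t ht).1.const_mul c')).congr_deriv (by ring)
  · exact (((h t ht).2.const_mul c).add ((h' t ht).2.const_mul c')).congr_deriv (by ring)

/-- The quantity inside the absolute value on the left is the derivative of `u² + v²` along a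
solution. The two-sided bound gives Grönwall estimates both forwards and backwards in time. -/
lemma norm_sq_deriv_bounds (hp0 : ∀ t, a ≤ t → 0 ≤ p t) (hq0 : ∀ t, a ≤ t → 0 ≤ q t) {t : ℝ}
    (ht : a ≤ t) :
    |2 * (p t - q t) * (u t * v t)| ≤ (p t + q t) * (u t ^ 2 + v t ^ 2) := by
  have h1 : |2 * (u t * v t)| ≤ u t ^ 2 + v t ^ 2 :=
    abs_le.2 ⟨by nlinarith [sq_nonneg (u t + v t)], by nlinarith [sq_nonneg (u t - v t)]⟩
  have h2 : |p t - q t| ≤ p t + q t :=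
    abs_le.2 ⟨by linarith [hp0 t ht], by linarith [hq0 t ht]⟩
  rw [show 2 * (p t - q t) * (u t * v t) = (p t - q t) * (2 * (u t * v t)) by ring, abs_mul]
  exact mul_le_mul h2 h1 (abs_nonneg _) ((abs_nonneg _).trans h2)

lemma hasDerivWithinAt_norm_sq_mul_JExp (h : IsOffDiagSolution a p q u v)
    {r : ℝ → ℝ} (hr : ContinuousOn r (Ici a)) {t : ℝ} (ht : a ≤ t) :
    HasDerivWithinAt (fun t => (u t ^ 2 + v t ^ 2) * JExp r a t)
      ((2 * (p t - q t) * (u t * v t) + r t * (u t ^ 2 + v t ^ 2)) * JExp r a t) (Ici a) t := by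
  exact ((((h t ht).1.pow 2).add ((h t ht).2.pow 2)).mul
    (hasDerivWithinAt_JExp hr ht)).congr_deriv (by simp; ring)

lemma norm_sq_le (hp : ContinuousOn p (Ici a)) (hq : ContinuousOn q (Ici a))
    (hp0 : ∀ t, a ≤ t → 0 ≤ p t) (hq0 : ∀ t, a ≤ t → 0 ≤ q t)
    (h : IsOffDiagSolution a p q u v) {t : ℝ} (ht : a ≤ t) :
    u t ^ 2 + v t ^ 2 ≤ (u a ^ 2 + v a ^ 2) * JExp (fun s => p s + q s) a t := by
  have key := antitoneOn_Ici_of_hasDerivWithinAt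
    (fun t ht => h.hasDerivWithinAt_norm_sq_mul_JExp (hp.add hq).neg ht) (fun t ht => by
      refine mul_nonpos_of_nonpos_of_nonneg ?_ (JExp_pos _ _ _).le
      have := (abs_le.1 (norm_sq_deriv_bounds (u := u) (v := v) hp0 hq0 ht)).2
      simp only [Pi.neg_apply, Pi.add_apply]
      linarith) self_mem_Ici ht ht
  have e : JExp (-(p + q)) a t = (JExp (fun s => p s + q s) a t)⁻¹ := JExp_neg _ _ _
  have e0 : JExp (-(p + q)) a a = 1 := by simp [JExp]
  simp only [e, e0, mul_one] at key
  rwa [← div_eq_mul_inv, div_le_iff₀ (JExp_pos _ _ _)] at key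

lemma JExp_le (hpi : IntegrableOn p (Ioi a)) (hp0 : ∀ t, a ≤ t → 0 ≤ p t) {t : ℝ} (ht : a ≤ t) :
    JExp p a t ≤ Real.exp (∫ τ in Ioi a, p τ) := by
  refine Real.exp_le_exp.2 ?_
  rw [intervalIntegral.integral_of_le ht]
  exact setIntegral_mono_set hpi ((ae_restrict_mem measurableSet_Ioi).mono
    fun s hs => hp0 s (le_of_lt hs)) Ioc_subset_Ioi_self.eventuallyLE

lemma exists_bound (hp : ContinuousOn p (Ici a)) (hq : ContinuousOn q (Ici a))
    (hp0 : ∀ t, a ≤ t → 0 ≤ p t) (hq0 : ∀ t, a ≤ t → 0 ≤ q t)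
    (hpi : IntegrableOn p (Ioi a)) (hqi : IntegrableOn q (Ioi a))
    (h : IsOffDiagSolution a p q u v) : ∃ C, ∀ t, a ≤ t → |v t| ≤ C := by
  refine ⟨Real.sqrt ((u a ^ 2 + v a ^ 2) * Real.exp (∫ τ in Ioi a, (p τ + q τ))),
    fun t ht => Real.abs_le_sqrt ?_⟩
  have h1 := h.norm_sq_le hp hq hp0 hq0 ht
  have h2 := JExp_le (p := fun s => p s + q s) (hpi.add hqi)
    (fun t ht => add_nonneg (hp0 t ht) (hq0 t ht)) ht
  have h3 := mul_le_mul_of_nonneg_left h2 (show 0 ≤ u a ^ 2 + v a ^ 2 by positivity)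
  nlinarith [sq_nonneg (u t)]

/-- Since `v` is bounded and `p` integrable, `u' = p v` is integrable up to infinity. -/
lemma exists_tendsto_fst (hp : ContinuousOn p (Ici a)) (hq : ContinuousOn q (Ici a))
    (hp0 : ∀ t, a ≤ t → 0 ≤ p t) (hq0 : ∀ t, a ≤ t → 0 ≤ q t)
    (hpi : IntegrableOn p (Ioi a)) (hqi : IntegrableOn q (Ioi a))
    (h : IsOffDiagSolution a p q u v) : ∃ b, Tendsto u atTop (𝓝 b) := by
  obtain ⟨C, hC⟩ := h.exists_bound hp hq hp0 hq0 hpi hqi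
  have hi : IntegrableOn (fun t => p t * v t) (Ioi a) := by
    refine Integrable.mul_bdd hpi
      ((h.continuousOn_snd.mono Ioi_subset_Ici_self).aestronglyMeasurable measurableSet_Ioi)
      (c := C) ?_
    exact (ae_restrict_mem measurableSet_Ioi).mono fun s hs => hC s (le_of_lt hs)
  refine ⟨_, ((intervalIntegral_tendsto_integral_Ioi a hi tendsto_id).const_add (u a)).congr' ?_⟩
  filter_upwards [eventually_ge_atTop a] with t ht
  rw [id, integral_eq_sub_of_hasDerivWithinAt_Ici (fun s hs => (h s hs).1)
    (hp.mul h.continuousOn_snd) le_rfl ht]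
  ring

lemma exists_tendsto (hp : ContinuousOn p (Ici a)) (hq : ContinuousOn q (Ici a))
    (hp0 : ∀ t, a ≤ t → 0 ≤ p t) (hq0 : ∀ t, a ≤ t → 0 ≤ q t)
    (hpi : IntegrableOn p (Ioi a)) (hqi : IntegrableOn q (Ioi a))
    (h : IsOffDiagSolution a p q u v) :
    ∃ b c, Tendsto u atTop (𝓝 b) ∧ Tendsto v atTop (𝓝 c) := by
  obtain ⟨b, hb⟩ := h.exists_tendsto_fst hp hq hp0 hq0 hpi hqi
  obtain ⟨c, hc⟩ := h.swap.exists_tendsto_fst hq hp hq0 hp0 hqi hpi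
  exact ⟨b, c, hb, hc⟩

/-- Grönwall from infinity: `(u² + v²) exp (∫ (p + q))` is nondecreasing, and it tends to `0`
because the exponential stays bounded. -/
lemma eq_zero_of_tendsto_zero (hp : ContinuousOn p (Ici a)) (hq : ContinuousOn q (Ici a))
    (hp0 : ∀ t, a ≤ t → 0 ≤ p t) (hq0 : ∀ t, a ≤ t → 0 ≤ q t)
    (hpi : IntegrableOn p (Ioi a)) (hqi : IntegrableOn q (Ioi a))
    (h : IsOffDiagSolution a p q u v) (hu : Tendsto u atTop (𝓝 0)) (hv : Tendsto v atTop (𝓝 0))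
    {t : ℝ} (ht : a ≤ t) : u t = 0 ∧ v t = 0 := by
  have mono := monotoneOn_Ici_of_hasDerivWithinAt
    (fun t ht => h.hasDerivWithinAt_norm_sq_mul_JExp (hp.add hq) ht) (fun t ht => by
      refine mul_nonneg ?_ (JExp_pos _ _ _).le
      have := (abs_le.1 (norm_sq_deriv_bounds (u := u) (v := v) hp0 hq0 ht)).1
      simp only [Pi.add_apply]
      linarith)
  have hN : Tendsto (fun t => (u t ^ 2 + v t ^ 2) * JExp (p + q) a t) atTop (𝓝 0) := by
    refine Tendsto.zero_mul_isBoundedUnder_le (by simpa using (hu.pow 2).add (hv.pow 2)) ?_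
    refine ⟨Real.exp (∫ τ in Ioi a, (p τ + q τ)), eventually_map.2 ?_⟩
    filter_upwards [eventually_ge_atTop a] with s hs
    simp only [Function.comp, Real.norm_eq_abs, abs_of_pos (JExp_pos (p + q) a s)]
    exact JExp_le (p := p + q) (hpi.add hqi) (fun t ht => add_nonneg (hp0 t ht) (hq0 t ht)) hs
  have hle : (u t ^ 2 + v t ^ 2) * JExp (p + q) a t ≤ 0 := by
    refine ge_of_tendsto hN ?_
    filter_upwards [eventually_ge_atTop t] with s hs
    exact mono ht (ht.trans hs) hs
  have := nonpos_of_mul_nonpos_left hle (JExp_pos _ _ _)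
  constructor <;> nlinarith [sq_nonneg (u t), sq_nonneg (v t)]

/-- If `u → 0` and `v` tends to a negative limit, then eventually `u` is positive and `v`
is negative. -/
lemma eventually_signs (hp0 : ∀ t, a ≤ t → 0 ≤ p t)
    (hsupp : ∀ T, a ≤ T → ∃ t, T ≤ t ∧ p t ≠ 0)
    (h : IsOffDiagSolution a p q u v) (hu : Tendsto u atTop (𝓝 0)) {c : ℝ} (hc : c < 0)
    (hv : Tendsto v atTop (𝓝 c)) : ∃ T, a < T ∧ ∀ t, T ≤ t → 0 < u t ∧ v t < 0 := by
  obtain ⟨T, hT⟩ := eventually_atTop.1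
    ((hv.eventually (gt_mem_nhds hc)).and (eventually_gt_atTop a))
  have haT : a < T := (hT T le_rfl).2
  have anti : AntitoneOn u (Ici T) := antitoneOn_Ici_of_hasDerivWithinAt
    (fun t ht => (h t (haT.le.trans ht)).1.mono (Ici_subset_Ici.2 haT.le))
    (fun t ht => mul_nonpos_of_nonneg_of_nonpos (hp0 t (haT.le.trans ht)) (hT t ht).1.le)
  have nonneg : ∀ t, T ≤ t → 0 ≤ u t := fun t ht => by
    refine le_of_tendsto hu ?_
    filter_upwards [eventually_ge_atTop t] with s hs
    exact anti ht (ht.trans hs) hs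
  refine ⟨T, haT, fun t ht => ⟨(nonneg t ht).lt_of_ne fun h0 => ?_, (hT t ht).1⟩⟩
  -- A zero of the nonincreasing, nonnegative `u` at `t` forces `u = 0` on `[t, ∞)`. Then `p v = u'`
  -- vanishes at some `s ≥ t` with `p s ≠ 0` and `v s < 0`. Right derivatives are used because `s =
  -- t` is possible.
  obtain ⟨s, hs, hps⟩ := hsupp t (haT.le.trans ht)
  have hzero : ∀ x ∈ Ici t, u x = 0 := fun x hx =>
    le_antisymm ((anti ht (ht.trans hx) hx).trans h0.ge) (nonneg x (ht.trans hx))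
  have hts : T ≤ s := ht.trans hs
  have h1 : HasDerivWithinAt u (p s * v s) (Ici s) s :=
    (h s (haT.le.trans hts)).1.mono (Ici_subset_Ici.2 (haT.le.trans hts))
  have h2 : HasDerivWithinAt u 0 (Ici s) s :=
    (hasDerivWithinAt_const s (Ici s) (0 : ℝ)).congr (fun x hx => hzero x (hs.trans hx))
      (hzero s hs)
  have := (uniqueDiffWithinAt_Ici s).eq_deriv _ h1 h2
  exact (mul_ne_zero hps (hT s hts).1.ne) this

end IsOffDiagSolution

/-! ### Existence of solutions with prescribed limits, by a weighted contraction. -/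

/-- The weight `exp (2 ∫_t^∞ r)`. -/
noncomputable def tailWeight (r : ℝ → ℝ) (t : ℝ) : ℝ := Real.exp (2 * ∫ τ in Ioi t, r τ)

section TailWeight

variable {r : ℝ → ℝ} {a : ℝ}

lemma tailWeight_pos (r : ℝ → ℝ) (t : ℝ) : 0 < tailWeight r t := Real.exp_pos _

lemma hasDerivWithinAt_tailWeight (hr : ContinuousOn r (Ici a)) (hi : IntegrableOn r (Ioi a))
    {t : ℝ} (ht : a ≤ t) :
    HasDerivWithinAt (tailWeight r) (-(2 * (r t * tailWeight r t))) (Ici a) t :=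
  (((hasDerivWithinAt_integral_Ioi hr hi ht).const_mul 2).exp).congr_deriv (by
    rw [tailWeight]; ring)

lemma continuousOn_tailWeight (hr : ContinuousOn r (Ici a)) (hi : IntegrableOn r (Ioi a)) :
    ContinuousOn (tailWeight r) (Ici a) :=
  fun _ ht => (hasDerivWithinAt_tailWeight hr hi ht).continuousWithinAt

lemma one_le_tailWeight (hr0 : ∀ t, a ≤ t → 0 ≤ r t) {t : ℝ} (ht : a ≤ t) :
    1 ≤ tailWeight r t :=
  Real.one_le_exp (mul_nonneg zero_le_two (setIntegral_nonneg measurableSet_Ioi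
    fun s hs => hr0 s (ht.trans (le_of_lt hs))))

lemma tailWeight_le (hr : ContinuousOn r (Ici a)) (hi : IntegrableOn r (Ioi a))
    (hr0 : ∀ t, a ≤ t → 0 ≤ r t) {t : ℝ} (ht : a ≤ t) : tailWeight r t ≤ tailWeight r a :=
  antitoneOn_Ici_of_hasDerivWithinAt (fun _ hs => hasDerivWithinAt_tailWeight hr hi hs)
    (fun s hs => neg_nonpos.2 (mul_nonneg zero_le_two
      (mul_nonneg (hr0 s hs) (tailWeight_pos r s).le))) self_mem_Ici ht ht

lemma integrableOn_mul_tailWeight {p : ℝ → ℝ} (hr : ContinuousOn r (Ici a))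
    (hi : IntegrableOn r (Ioi a)) (hr0 : ∀ t, a ≤ t → 0 ≤ r t) (hp : IntegrableOn p (Ioi a)) :
    IntegrableOn (fun t => p t * tailWeight r t) (Ioi a) := by
  refine Integrable.mul_bdd (c := tailWeight r a) hp
    (((continuousOn_tailWeight hr hi).mono Ioi_subset_Ici_self).aestronglyMeasurable
      measurableSet_Ioi) ((ae_restrict_mem measurableSet_Ioi).mono fun s hs => ?_)
  rw [Real.norm_eq_abs, abs_of_pos (tailWeight_pos r s)]
  exact tailWeight_le hr hi hr0 (le_of_lt hs)

lemma tendsto_tailWeight (hi : IntegrableOn r (Ioi a)) :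
    Tendsto (tailWeight r) atTop (𝓝 1) := by
  have := (Real.continuous_exp.tendsto _).comp ((tendsto_integral_Ioi_atTop hi).const_mul 2)
  rwa [mul_zero, Real.exp_zero] at this

/-- `r W` is the derivative of `-W / 2`, and `W → 1`. The factor `2` in the exponent of the weight
is what produces the contraction constant `1 / 2`. -/
lemma integral_mul_tailWeight (hr : ContinuousOn r (Ici a))
    (hi : IntegrableOn r (Ioi a)) (hr0 : ∀ t, a ≤ t → 0 ≤ r t) {t : ℝ} (ht : a ≤ t) :
    ∫ τ in Ioi t, r τ * tailWeight r τ = (tailWeight r t - 1) / 2 := by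
  have hd : ∀ s, a ≤ s → HasDerivWithinAt (fun s => -(tailWeight r s / 2))
      (r s * tailWeight r s) (Ici a) s := fun s hs =>
    ((hasDerivWithinAt_tailWeight hr hi hs).div_const 2).neg.congr_deriv (by ring)
  rw [integral_Ioi_of_hasDerivAt_of_tendsto
    ((hd t ht).continuousWithinAt.mono (Ici_subset_Ici.2 ht))
    (fun s hs => (hd s (ht.trans (le_of_lt hs))).hasDerivAt (Ici_mem_nhds (ht.trans_lt hs)))
    ((integrableOn_mul_tailWeight hr hi hr0 hi).mono_set (Ioi_subset_Ioi ht))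
    ((tendsto_tailWeight hi).div_const 2).neg]
  ring

lemma abs_integral_mul_tailWeight_mul_le {p x : ℝ → ℝ} {C : ℝ} (hr : ContinuousOn r (Ici a))
    (hi : IntegrableOn r (Ioi a)) (hr0 : ∀ t, a ≤ t → 0 ≤ r t)
    (hpr : ∀ t, a ≤ t → |p t| ≤ r t) (hx : ∀ t, |x t| ≤ C) {t : ℝ} (ht : a ≤ t) :
    |∫ τ in Ioi t, p τ * tailWeight r τ * x τ| ≤ tailWeight r t * (C / 2) := by
  have hC : 0 ≤ C := (abs_nonneg _).trans (hx a)
  have h1 : ‖∫ τ in Ioi t, p τ * tailWeight r τ * x τ‖ ≤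
      ∫ τ in Ioi t, r τ * tailWeight r τ * C := by
    refine norm_integral_le_of_norm_le
      (((integrableOn_mul_tailWeight hr hi hr0 hi).mono_set (Ioi_subset_Ioi ht)).mul_const C)
      ((ae_restrict_mem measurableSet_Ioi).mono fun s hs => ?_)
    have hs' : a ≤ s := ht.trans (le_of_lt hs)
    rw [Real.norm_eq_abs, abs_mul, abs_mul, abs_of_pos (tailWeight_pos r s)]
    exact mul_le_mul (mul_le_mul_of_nonneg_right (hpr s hs') (tailWeight_pos r s).le) (hx s)
      (abs_nonneg _) (mul_nonneg (hr0 s hs') (tailWeight_pos r s).le)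
  rw [integral_mul_const, integral_mul_tailWeight hr hi hr0 ht] at h1
  exact h1.trans (by nlinarith)

/-- The operator `x ↦ W⁻¹ (c + ∫_t^∞ p W x)`, `W` the tail weight, halves distances of bounded
continuous functions. -/
lemma exists_lipschitz_tail_operator {p : ℝ → ℝ} (hr : ContinuousOn r (Ici a))
    (hi : IntegrableOn r (Ioi a)) (hr0 : ∀ t, a ≤ t → 0 ≤ r t) (hp : ContinuousOn p (Ici a))
    (hpi : IntegrableOn p (Ioi a)) (hpr : ∀ t, a ≤ t → |p t| ≤ r t) (c : ℝ) :
    ∃ K : (ℝ →ᵇ ℝ) → (ℝ →ᵇ ℝ), LipschitzWith (1 / 2) K ∧ ∀ x t, a ≤ t →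
      tailWeight r t * K x t = c + ∫ τ in Ioi t, p τ * tailWeight r τ * x τ := by
  have hint : ∀ x : ℝ →ᵇ ℝ, IntegrableOn (fun τ => p τ * tailWeight r τ * x τ) (Ioi a) :=
    fun x => Integrable.mul_bdd (c := ‖x‖) (integrableOn_mul_tailWeight hr hi hr0 hpi)
      x.continuous.aestronglyMeasurable (ae_of_all _ x.norm_coe_le_norm)
  have hcont : ∀ x : ℝ →ᵇ ℝ, ContinuousOn (fun τ => p τ * tailWeight r τ * x τ) (Ici a) :=
    fun x => (hp.mul (continuousOn_tailWeight hr hi)).mul x.continuous.continuousOn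
  let F : (ℝ →ᵇ ℝ) → ℝ → ℝ := fun x t =>
    (tailWeight r t)⁻¹ * (c + ∫ τ in Ioi t, p τ * tailWeight r τ * x τ)
  -- Evaluating at `max a t` gives functions on all of `ℝ`, so that the complete space `ℝ →ᵇ ℝ` can
  -- be used; only values on `[a, ∞)` matter.
  have hF : ∀ x, Continuous fun t => F x (max a t) := fun x =>
    continuous_comp_max (((continuousOn_tailWeight hr hi).inv₀
      fun t _ => (tailWeight_pos r t).ne').mul (continuousOn_const.add fun t ht =>
        (hasDerivWithinAt_integral_Ioi (hcont x) (hint x) ht).continuousWithinAt))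
  have hdiff : ∀ x y t, |F x (max a t) - F y (max a t)| ≤ 1 / 2 * dist x y := by
    intro x y t
    have ht : a ≤ max a t := le_max_left a t
    generalize max a t = s at ht
    have hsub : F x s - F y s = (tailWeight r s)⁻¹ *
        ∫ τ in Ioi s, p τ * tailWeight r τ * (x τ - y τ) := by
      simp only [F, mul_sub]
      rw [integral_sub ((hint x).mono_set (Ioi_subset_Ioi ht))
        ((hint y).mono_set (Ioi_subset_Ioi ht))]
      ring
    have hb := abs_integral_mul_tailWeight_mul_le (x := fun τ => x τ - y τ) (C := dist x y)
      hr hi hr0 hpr (fun τ => x.dist_coe_le_dist τ) ht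
    rw [hsub, abs_mul, abs_inv, abs_of_pos (tailWeight_pos r s),
      inv_mul_le_iff₀ (tailWeight_pos r s)]
    linarith
  have hzero : ∀ t, |F 0 (max a t)| ≤ |c| := by
    intro t
    have h1 := one_le_tailWeight hr0 (le_max_left a t)
    simp only [F, BoundedContinuousFunction.coe_zero, Pi.zero_apply, mul_zero,
      integral_zero, add_zero, abs_mul, abs_inv, abs_of_pos (tailWeight_pos r (max a t))]
    exact mul_le_of_le_one_left (abs_nonneg c) (inv_le_one_of_one_le₀ h1)
  have hbdd : ∀ x t, ‖F x (max a t)‖ ≤ 1 / 2 * dist x 0 + |c| := fun x t => by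
    have := abs_sub_abs_le_abs_sub (F x (max a t)) (F 0 (max a t))
    rw [Real.norm_eq_abs]
    linarith [hdiff x 0 t, hzero t]
  refine ⟨fun x => BoundedContinuousFunction.ofNormedAddCommGroup _ (hF x) _ (hbdd x), ?_, ?_⟩
  · refine LipschitzWith.of_dist_le_mul fun x y => ?_
    refine (BoundedContinuousFunction.dist_le (by positivity)).2 fun t => ?_
    simpa [Real.dist_eq] using hdiff x y t
  · intro x t ht
    simp only [BoundedContinuousFunction.coe_ofNormedAddCommGroup, max_eq_right ht, F]
    rw [mul_inv_cancel_left₀ (tailWeight_pos r t).ne']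

end TailWeight

/-- A solution with prescribed limits at infinity. -/
theorem exists_isOffDiagSolution_tendsto {a : ℝ} {p q : ℝ → ℝ} (hp : ContinuousOn p (Ici a))
    (hq : ContinuousOn q (Ici a)) (hp0 : ∀ t, a ≤ t → 0 ≤ p t) (hq0 : ∀ t, a ≤ t → 0 ≤ q t)
    (hpi : IntegrableOn p (Ioi a)) (hqi : IntegrableOn q (Ioi a)) (b c : ℝ) :
    ∃ u v, IsOffDiagSolution a p q u v ∧ Tendsto u atTop (𝓝 b) ∧ Tendsto v atTop (𝓝 c) := by
  have hr : ContinuousOn (fun t => p t + q t) (Ici a) := hp.add hq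
  have hi : IntegrableOn (fun t => p t + q t) (Ioi a) := hpi.add hqi
  have hr0 : ∀ t, a ≤ t → 0 ≤ p t + q t := fun t ht => add_nonneg (hp0 t ht) (hq0 t ht)
  obtain ⟨K, hK, hKeq⟩ := exists_lipschitz_tail_operator (p := fun t => -p t) hr hi hr0 hp.neg
    hpi.neg (fun t ht => by rw [abs_neg, abs_of_nonneg (hp0 t ht)]; linarith [hq0 t ht]) b
  obtain ⟨M, hM, hMeq⟩ := exists_lipschitz_tail_operator hr hi hr0 hq hqi
    (fun t ht => by rw [abs_of_nonneg (hq0 t ht)]; linarith [hp0 t ht]) c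
  -- At a fixed point `(x, y)`, the functions `u = W x` and `v = W y` satisfy `u = b - ∫_t^∞ p v`
  -- and `v = c + ∫_t^∞ q u`, the integral form of the system with its limits.
  have hcontr : ContractingWith (1 / 2) fun z : (ℝ →ᵇ ℝ) × (ℝ →ᵇ ℝ) => (K z.2, M z.1) := by
    refine ⟨by norm_num, ?_⟩
    have := (hK.comp LipschitzWith.prod_snd).prodMk (hM.comp LipschitzWith.prod_fst)
    simpa using this
  obtain ⟨⟨x, y⟩, hfix⟩ : ∃ z : (ℝ →ᵇ ℝ) × (ℝ →ᵇ ℝ), (K z.2, M z.1) = z :=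
    ⟨_, hcontr.fixedPoint_isFixedPt⟩
  obtain ⟨hx, hy⟩ := Prod.mk.inj hfix
  set W := tailWeight fun t => p t + q t
  have hWc : ContinuousOn W (Ici a) := continuousOn_tailWeight hr hi
  have hxW : ∀ t, a ≤ t → W t * x t = b + ∫ τ in Ioi t, -p τ * W τ * y τ := fun t ht => by
    simpa only [hx] using hKeq y t ht
  have hyW : ∀ t, a ≤ t → W t * y t = c + ∫ τ in Ioi t, q τ * W τ * x τ := fun t ht => by
    simpa only [hy] using hMeq x t ht
  have hpy : IntegrableOn (fun τ => -p τ * W τ * y τ) (Ioi a) :=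
    Integrable.mul_bdd (c := ‖y‖) (integrableOn_mul_tailWeight hr hi hr0 hpi.neg)
      y.continuous.aestronglyMeasurable (ae_of_all _ y.norm_coe_le_norm)
  have hqx : IntegrableOn (fun τ => q τ * W τ * x τ) (Ioi a) :=
    Integrable.mul_bdd (c := ‖x‖) (integrableOn_mul_tailWeight hr hi hr0 hqi)
      x.continuous.aestronglyMeasurable (ae_of_all _ x.norm_coe_le_norm)
  refine ⟨fun t => W t * x t, fun t => W t * y t, fun t ht => ⟨?_, ?_⟩, ?_, ?_⟩
  · have := (hasDerivWithinAt_integral_Ioi ((hp.neg.mul hWc).mul y.continuous.continuousOn)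
      hpy ht).const_add b
    exact (this.congr hxW (hxW t ht)).congr_deriv (by simp; ring)
  · have := (hasDerivWithinAt_integral_Ioi ((hq.mul hWc).mul x.continuous.continuousOn)
      hqx ht).const_add c
    exact (this.congr hyW (hyW t ht)).congr_deriv (by simp; ring)
  · have := (tendsto_integral_Ioi_atTop hpy).const_add b
    rw [add_zero] at this
    exact this.congr' ((eventually_ge_atTop a).mono fun t ht => (hxW t ht).symm)
  · have := (tendsto_integral_Ioi_atTop hqx).const_add c
    rw [add_zero] at this
    exact this.congr' ((eventually_ge_atTop a).mono fun t ht => (hyW t ht).symm)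

/-! ### Improper integrals, in general and along solutions. -/

section Improper

variable {f g : ℝ → ℝ} {T : ℝ}

lemma eventuallyEq_integral_of_eqOn_Ici (h : ∀ t, T ≤ t → f t = g t) :
    (fun t => ∫ τ in T..t, f τ) =ᶠ[atTop] fun t => ∫ τ in T..t, g τ := by
  filter_upwards [eventually_ge_atTop T] with t ht
  refine intervalIntegral.integral_congr fun τ hτ => h τ ?_
  rw [uIcc_of_le ht] at hτ
  exact hτ.1

lemma ImproperConverges.congr (hf : ImproperConverges f T) (h : ∀ t, T ≤ t → f t = g t) :
    ImproperConverges g T :=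
  hf.imp fun _ hL => hL.congr' (eventuallyEq_integral_of_eqOn_Ici h)

lemma ImproperEqTop.congr (hf : ImproperEqTop f T) (h : ∀ t, T ≤ t → f t = g t) :
    ImproperEqTop g T :=
  Tendsto.congr' (eventuallyEq_integral_of_eqOn_Ici h) hf

lemma ImproperEqBot.congr (hf : ImproperEqBot f T) (h : ∀ t, T ≤ t → f t = g t) :
    ImproperEqBot g T :=
  Tendsto.congr' (eventuallyEq_integral_of_eqOn_Ici h) hf

lemma ImproperEqTop.neg (hf : ImproperEqTop f T) : ImproperEqBot (fun t => -f t) T := by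
  simp only [ImproperEqBot, intervalIntegral.integral_neg]
  exact tendsto_neg_atTop_atBot.comp hf

end Improper

/-- Nonnegativity of the integrand upgrades convergence of the improper integral to Lebesgue
integrability. -/
lemma integrableOn_Ioi_of_tendsto_IPlus {f g : ℝ → ℝ} {a L : ℝ} (hf : ContinuousOn f (Ici a))
    (hg : ContinuousOn g (Ici a)) (hf0 : ∀ t, a ≤ t → 0 ≤ f t)
    (h : Tendsto (IPlus f g a) atTop (𝓝 L)) :
    IntegrableOn (fun τ => f τ * JExp (fun s => -g s) a τ) (Ioi a) := by
  have hc : ContinuousOn (fun τ => f τ * JExp (fun s => -g s) a τ) (Ici a) :=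
    hf.mul (continuousOn_JExp hg.neg)
  refine integrableOn_Ioi_of_intervalIntegral_norm_tendsto L a (b := fun t => t) (l := atTop)
    (fun t => ?_) tendsto_id (h.congr' ?_)
  · exact ((hc.mono Icc_subset_Ici_self).integrableOn_Icc).mono_set Ioc_subset_Icc_self
  · refine eventuallyEq_integral_of_eqOn_Ici fun t ht => ?_
    rw [Real.norm_of_nonneg (mul_nonneg (hf0 t ht) (JExp_pos _ _ _).le)]

namespace IsOffDiagSolution

variable {a : ℝ} {p q u v : ℝ → ℝ}

lemma restrict (h : IsOffDiagSolution a p q u v) {T : ℝ} (hT : a ≤ T) :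
    IsOffDiagSolution T p q u v :=
  fun t ht => ⟨(h t (hT.trans ht)).1.mono (Ici_subset_Ici.2 hT),
    (h t (hT.trans ht)).2.mono (Ici_subset_Ici.2 hT)⟩

lemma integral_mul_div (h : IsOffDiagSolution a p q u v) (hp : ContinuousOn p (Ici a))
    (hu : ∀ t, a ≤ t → u t ≠ 0) {t : ℝ} (ht : a ≤ t) :
    ∫ τ in a..t, p τ * (v τ / u τ) = Real.log (u t) - Real.log (u a) := by
  refine integral_eq_sub_of_hasDerivWithinAt_Ici (f := fun t => Real.log (u t))
    (fun s hs => ((h s hs).1.log (hu s hs)).congr_deriv (mul_div_assoc _ _ _)) ?_ le_rfl ht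
  exact hp.mul (h.continuousOn_snd.div h.continuousOn_fst hu)

/-- The integrand is `(log u)'`, and `log u → -∞`. -/
lemma improperEqBot_mul_div (h : IsOffDiagSolution a p q u v) (hp : ContinuousOn p (Ici a))
    (hu : ∀ t, a ≤ t → 0 < u t) (hlim : Tendsto u atTop (𝓝 0)) :
    ImproperEqBot (fun τ => p τ * (v τ / u τ)) a := by
  have h1 : Tendsto u atTop (𝓝[>] 0) := tendsto_nhdsWithin_iff.2
    ⟨hlim, (eventually_ge_atTop a).mono fun t ht => hu t ht⟩
  have h2 := tendsto_atBot_add_const_right atTop (-Real.log (u a))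
    (Real.tendsto_log_nhdsGT_zero.comp h1)
  refine h2.congr' ((eventually_ge_atTop a).mono fun t ht => ?_)
  exact (sub_eq_add_neg _ _).symm.trans
    (h.integral_mul_div hp (fun s hs => (hu s hs).ne') ht).symm

/-- Compare with `(1/u)' = -p v / u² ≤ C p / u²`, whose integral diverges because `1/u → ∞`. -/
lemma improperEqTop_div_sq (h : IsOffDiagSolution a p q u v) (hp : ContinuousOn p (Ici a))
    (hp0 : ∀ t, a ≤ t → 0 ≤ p t) (hu : ∀ t, a ≤ t → 0 < u t) {C : ℝ} (hC : 0 < C)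
    (hv : ∀ t, a ≤ t → |v t| ≤ C) (hlim : Tendsto u atTop (𝓝 0)) :
    ImproperEqTop (fun τ => p τ / u τ ^ 2) a := by
  have h1 : Tendsto u atTop (𝓝[>] 0) := tendsto_nhdsWithin_iff.2
    ⟨hlim, (eventually_ge_atTop a).mono fun t ht => hu t ht⟩
  have h2 := (tendsto_atTop_add_const_right atTop (-(u a)⁻¹)
    (tendsto_inv_nhdsGT_zero.comp h1)).const_mul_atTop (inv_pos.2 hC)
  have hune : ∀ t, a ≤ t → u t ≠ 0 := fun t ht => (hu t ht).ne'
  have hc1 : ContinuousOn (fun τ => -(p τ * v τ) / u τ ^ 2) (Ici a) :=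
    (hp.mul h.continuousOn_snd).neg.div (h.continuousOn_fst.pow 2)
      fun t ht => pow_ne_zero 2 (hune t ht)
  have hc2 : ContinuousOn (fun τ => p τ / u τ ^ 2) (Ici a) :=
    hp.div (h.continuousOn_fst.pow 2) fun t ht => pow_ne_zero 2 (hune t ht)
  refine tendsto_atTop_mono' atTop ((eventually_ge_atTop a).mono fun t ht => ?_) h2
  rw [inv_mul_le_iff₀ hC]
  have e := integral_eq_sub_of_hasDerivWithinAt_Ici (f := fun t => (u t)⁻¹)
    (fun s hs => (h s hs).1.inv (hune s hs)) hc1 le_rfl ht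
  change (u t)⁻¹ + -(u a)⁻¹ ≤ _
  rw [← sub_eq_add_neg, ← e, ← intervalIntegral.integral_const_mul]
  refine intervalIntegral.integral_mono_on ht
    (intervalIntegrable_of_continuousOn_Ici hc1 le_rfl ht)
    ((intervalIntegrable_of_continuousOn_Ici hc2 le_rfl ht).const_mul C) fun s hs => ?_
  rw [← mul_div_assoc]
  have := mul_le_mul_of_nonneg_left (neg_le_of_abs_le (hv s hs.1)) (hp0 s hs.1)
  exact div_le_div_of_nonneg_right (by linarith) (sq_nonneg _)

lemma improperConverges_mul_div (h : IsOffDiagSolution a p q u v) (hp : ContinuousOn p (Ici a))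
    (hu : ∀ t, a ≤ t → u t ≠ 0) {b : ℝ} (hb : b ≠ 0) (hlim : Tendsto u atTop (𝓝 b)) :
    ImproperConverges (fun τ => p τ * (v τ / u τ)) a := by
  refine ⟨_, ((hlim.log hb).sub_const (Real.log (u a))).congr' ?_⟩
  filter_upwards [eventually_ge_atTop a] with t ht
  exact (h.integral_mul_div hp hu ht).symm

/-- A nonzero limit of `u` makes the integrand `O(p)`. -/
lemma improperConverges_div_sq (h : IsOffDiagSolution a p q u v) (hp : ContinuousOn p (Ici a))
    (hpi : IntegrableOn p (Ioi a))
    (hu : ∀ t, a ≤ t → u t ≠ 0) {b : ℝ} (hb : b ≠ 0) (hlim : Tendsto u atTop (𝓝 b)) :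
    ImproperConverges (fun τ => p τ / u τ ^ 2) a := by
  have hc : ContinuousOn (fun τ => p τ / u τ ^ 2) (Ici a) :=
    hp.div (h.continuousOn_fst.pow 2) fun t ht => pow_ne_zero 2 (hu t ht)
  have hO : (fun τ => p τ / u τ ^ 2) =O[atTop] p := by
    have h1 : (fun τ => (u τ ^ 2)⁻¹) =O[atTop] fun _ => (1 : ℝ) :=
      ((hlim.pow 2).inv₀ (pow_ne_zero 2 hb)).isBigO_one ℝ
    simpa [div_eq_mul_inv] using (Asymptotics.isBigO_refl p atTop).mul h1
  have hi := (hc.locallyIntegrableOn measurableSet_Ici).integrableOn_of_isBigO_atTop hO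
    ⟨Ioi a, Ioi_mem_atTop a, hpi⟩
  exact ⟨_, intervalIntegral_tendsto_integral_Ioi a (hi.mono_set Ioi_subset_Ici_self) tendsto_id⟩

end IsOffDiagSolution

lemma IsOffDiagSolution.eventually_fst_ne_zero {a : ℝ} {p q u v : ℝ → ℝ}
    (hp : ContinuousOn p (Ici a)) (hq : ContinuousOn q (Ici a))
    (hp0 : ∀ t, a ≤ t → 0 ≤ p t) (hq0 : ∀ t, a ≤ t → 0 ≤ q t)
    (hpi : IntegrableOn p (Ioi a)) (hqi : IntegrableOn q (Ioi a))
    (hsupp : ∀ T, a ≤ T → ∃ t, T ≤ t ∧ p t ≠ 0)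
    (h : IsOffDiagSolution a p q u v) (hne : NontrivialPair a u v) : ∀ᶠ t in atTop, u t ≠ 0 := by
  obtain ⟨b, c, hb, hc⟩ := h.exists_tendsto hp hq hp0 hq0 hpi hqi
  by_cases hb0 : b = 0
  · subst hb0
    have hc0 : c ≠ 0 := by
      rintro rfl
      obtain ⟨t, ht, hne⟩ := hne
      obtain ⟨h1, h2⟩ := h.eq_zero_of_tendsto_zero hp hq hp0 hq0 hpi hqi hb hc ht
      exact hne.elim (absurd h1) (absurd h2)
    -- Scaling by `-1/c` normalizes the limits to `(0, -1)`; the second summand has coefficient `0`.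
    obtain ⟨T, -, hT⟩ := (h.linear_comb h (-c⁻¹) 0).eventually_signs hp0 hsupp (c := -1)
      (by simpa using hb.const_mul (-c⁻¹)) (by norm_num)
      (by simpa [hc0] using hc.const_mul (-c⁻¹))
    filter_upwards [eventually_ge_atTop T] with t ht hu
    simpa [hu] using (hT t ht).1
  · exact hb.eventually_ne hb0

/-! ### Passage between the given and the reduced system; minimal solutions. -/

section System

variable {a : ℝ} {a₁₁ a₁₂ a₂₁ a₂₂ φ ψ : ℝ → ℝ}

/-- The upper right coefficient after removing the diagonal of the system. -/
noncomputable def reducedFst (a : ℝ) (a₁₁ a₁₂ a₂₂ : ℝ → ℝ) (t : ℝ) : ℝ :=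
  a₁₂ t * JExp (fun s => -(a₁₁ s - a₂₂ s)) a t

lemma continuousOn_reducedFst (h₁₁ : ContinuousOn a₁₁ (Ici a)) (h₁₂ : ContinuousOn a₁₂ (Ici a))
    (h₂₂ : ContinuousOn a₂₂ (Ici a)) : ContinuousOn (reducedFst a a₁₁ a₁₂ a₂₂) (Ici a) :=
  h₁₂.mul (continuousOn_JExp (h₁₁.sub h₂₂).neg)

lemma reducedFst_eq (h₁₁ : ContinuousOn a₁₁ (Ici a)) (h₂₂ : ContinuousOn a₂₂ (Ici a)) {t : ℝ}
    (ht : a ≤ t) :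
    reducedFst a a₁₁ a₁₂ a₂₂ t = a₁₂ t * (JExp a₂₂ a t / JExp a₁₁ a t) := by
  have h := JExp_add (h₁₁.sub h₂₂).neg h₁₁ ht
  have e : (fun s => (-(a₁₁ - a₂₂)) s + a₁₁ s) = a₂₂ := by
    funext s
    simp
  rw [e] at h
  rw [h, mul_div_cancel_right₀ _ (JExp_pos _ _ _).ne']
  rfl

/-- Removing the diagonal of the system. -/
lemma IsSolution.isOffDiagSolution (h₁₁ : ContinuousOn a₁₁ (Ici a))
    (h₂₂ : ContinuousOn a₂₂ (Ici a)) (h : IsSolution a a₁₁ a₁₂ a₂₁ a₂₂ φ ψ) :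
    IsOffDiagSolution a (reducedFst a a₁₁ a₁₂ a₂₂) (reducedFst a a₂₂ (fun t => -a₂₁ t) a₁₁)
      (fun t => φ t / JExp a₁₁ a t) (fun t => ψ t / JExp a₂₂ a t) := by
  intro t ht
  have hE := (JExp_pos a₁₁ a t).ne'
  have hF := (JExp_pos a₂₂ a t).ne'
  constructor
  · refine ((h t ht).1.div (hasDerivWithinAt_JExp h₁₁ ht) hE).congr_deriv ?_
    rw [reducedFst_eq h₁₁ h₂₂ ht]
    field_simp
    ring
  · refine ((h t ht).2.div (hasDerivWithinAt_JExp h₂₂ ht) hF).congr_deriv ?_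
    rw [reducedFst_eq h₂₂ h₁₁ ht]
    field_simp
    ring

lemma IsOffDiagSolution.isSolution {u v : ℝ → ℝ} (h₁₁ : ContinuousOn a₁₁ (Ici a))
    (h₂₂ : ContinuousOn a₂₂ (Ici a))
    (h : IsOffDiagSolution a (reducedFst a a₁₁ a₁₂ a₂₂)
      (reducedFst a a₂₂ (fun t => -a₂₁ t) a₁₁) u v) :
    IsSolution a a₁₁ a₁₂ a₂₁ a₂₂ (fun t => JExp a₁₁ a t * u t) (fun t => JExp a₂₂ a t * v t) := by
  intro t ht
  have hE := (JExp_pos a₁₁ a t).ne'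
  have hF := (JExp_pos a₂₂ a t).ne'
  constructor
  · refine ((hasDerivWithinAt_JExp h₁₁ ht).mul (h t ht).1).congr_deriv ?_
    rw [reducedFst_eq h₁₁ h₂₂ ht]
    field_simp
  · refine ((hasDerivWithinAt_JExp h₂₂ ht).mul (h t ht).2).congr_deriv ?_
    rw [reducedFst_eq h₂₂ h₁₁ ht]
    field_simp
    ring

/-- The squared factor of `φ` times the quotient of factors in `reducedFst` is the product of the
two exponentials; this is where `J_S` comes from. -/
lemma reducedFst_div_sq (h₁₁ : ContinuousOn a₁₁ (Ici a)) (h₂₂ : ContinuousOn a₂₂ (Ici a)) {t : ℝ}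
    (ht : a ≤ t) :
    reducedFst a a₁₁ a₁₂ a₂₂ t / (φ t / JExp a₁₁ a t) ^ 2 =
      a₁₂ t * JExp (fun s => a₁₁ s + a₂₂ s) a t / φ t ^ 2 := by
  rw [reducedFst_eq h₁₁ h₂₂ ht, JExp_add h₁₁ h₂₂ ht, div_pow, div_div_eq_mul_div]
  have hE := (JExp_pos a₁₁ a t).ne'
  congr 1
  field_simp

lemma reducedFst_mul_div (h₁₁ : ContinuousOn a₁₁ (Ici a)) (h₂₂ : ContinuousOn a₂₂ (Ici a)) {t : ℝ}
    (ht : a ≤ t) :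
    reducedFst a a₁₁ a₁₂ a₂₂ t * ((ψ t / JExp a₂₂ a t) / (φ t / JExp a₁₁ a t)) =
      a₁₂ t * (ψ t / φ t) := by
  rw [reducedFst_eq h₁₁ h₂₂ ht]
  have hE := (JExp_pos a₁₁ a t).ne'
  have hF := (JExp_pos a₂₂ a t).ne'
  field_simp

/-- The quarter turn at the level of the original system; it preserves the sign and integrability
conditions and turns second components into first ones. -/
lemma IsSolution.swap (h : IsSolution a a₁₁ a₁₂ a₂₁ a₂₂ φ ψ) :
    IsSolution a a₂₂ (fun t => -a₂₁ t) (fun t => -a₁₂ t) a₁₁ ψ (fun t => -φ t) :=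
  fun t ht => ⟨(h t ht).2.congr_deriv (by ring), (h t ht).1.neg.congr_deriv (by ring)⟩

lemma IsSolution.of_swap
    (h : IsSolution a a₂₂ (fun t => -a₂₁ t) (fun t => -a₁₂ t) a₁₁ ψ φ) :
    IsSolution a a₁₁ a₁₂ a₂₁ a₂₂ (fun t => -φ t) ψ :=
  fun t ht => ⟨(h t ht).2.neg.congr_deriv (by ring), (h t ht).1.congr_deriv (by ring)⟩

lemma NontrivialPair.swap (h : NontrivialPair a φ ψ) : NontrivialPair a ψ fun t => -φ t := by
  obtain ⟨t, ht, h⟩ := h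
  exact ⟨t, ht, by simpa using h.symm⟩

lemma LinIndepPairs.swap {φ' ψ' : ℝ → ℝ} (h : LinIndepPairs a φ ψ φ' ψ') :
    LinIndepPairs a ψ (fun t => -φ t) ψ' fun t => -φ' t := by
  refine fun c₁ c₂ hc => h c₁ c₂ fun t ht => ⟨?_, (hc t ht).1⟩
  linarith [(hc t ht).2]

lemma LinIndepPairs.symm {φ' ψ' : ℝ → ℝ} (h : LinIndepPairs a φ ψ φ' ψ') :
    LinIndepPairs a φ' ψ' φ ψ := by
  refine fun c₁ c₂ hc => (h c₂ c₁ fun t ht => ?_).symm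
  exact ⟨(add_comm _ _).trans (hc t ht).1, (add_comm _ _).trans (hc t ht).2⟩

lemma exists_eq_mul_of_not_linIndepPairs {φ' ψ' : ℝ → ℝ} (hne : NontrivialPair a φ ψ)
    (hne' : NontrivialPair a φ' ψ') (h : ¬ LinIndepPairs a φ ψ φ' ψ') :
    ∃ c : ℝ, c ≠ 0 ∧ ∀ t, a ≤ t → φ' t = c * φ t ∧ ψ' t = c * ψ t := by
  unfold LinIndepPairs at h
  push Not at h
  obtain ⟨c₁, c₂, hc, hc0⟩ := h
  have h2 : c₂ ≠ 0 := by
    rintro rfl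
    have h1 : c₁ ≠ 0 := fun h1 => hc0 h1 rfl
    obtain ⟨t, ht, hne⟩ := hne
    have := hc t ht
    simp only [zero_mul, add_zero, mul_eq_zero, h1, false_or] at this
    exact hne.elim (absurd this.1) (absurd this.2)
  have key : ∀ t, a ≤ t → φ' t = -(c₁ / c₂) * φ t ∧ ψ' t = -(c₁ / c₂) * ψ t := by
    intro t ht
    obtain ⟨e1, e2⟩ := hc t ht
    constructor <;> field_simp <;> linarith
  refine ⟨_, fun h0 => ?_, key⟩
  obtain ⟨t, ht, hne'⟩ := hne'
  have := key t ht
  rw [h0, zero_mul, zero_mul] at this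
  exact hne'.elim (absurd this.1) (absurd this.2)

/-- If the two were independent, both `φ / φ'` and `φ' / φ` would tend to `0`, although their
product is eventually `1`. -/
lemma IsMinimalFst.unique {φ' ψ' : ℝ → ℝ} (h : IsMinimalFst a a₁₁ a₁₂ a₂₁ a₂₂ φ ψ)
    (h' : IsMinimalFst a a₁₁ a₁₂ a₂₁ a₂₂ φ' ψ') :
    ∃ c : ℝ, c ≠ 0 ∧ ∀ t, a ≤ t → φ' t = c * φ t ∧ ψ' t = c * ψ t := by
  refine exists_eq_mul_of_not_linIndepPairs h.2.1 h'.2.1 fun hli => ?_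
  obtain ⟨n1, l1⟩ := h.2.2 φ' ψ' h'.1 hli
  obtain ⟨n2, l2⟩ := h'.2.2 φ ψ h.1 hli.symm
  have hlim := l1.mul l2
  rw [mul_zero] at hlim
  have hone : (fun t => φ t / φ' t * (φ' t / φ t)) =ᶠ[atTop] fun _ => (1 : ℝ) := by
    filter_upwards [n1, n2] with t h1 h2
    field_simp
  exact zero_ne_one (tendsto_nhds_unique (hlim.congr' hone) tendsto_const_nhds)

lemma IsMinimalSnd.swap (h : IsMinimalSnd a a₁₁ a₁₂ a₂₁ a₂₂ φ ψ) :
    IsMinimalFst a a₂₂ (fun t => -a₂₁ t) (fun t => -a₁₂ t) a₁₁ ψ (fun t => -φ t) := by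
  refine ⟨h.1.swap, h.2.1.swap, fun ψ' φ' hsol hli => h.2.2 _ ψ' hsol.of_swap ?_⟩
  refine fun c₁ c₂ hc => hli c₁ c₂ fun t ht => ⟨(hc t ht).2, ?_⟩
  linarith [(hc t ht).1]

lemma IsMinimalFst.of_swap
    (h : IsMinimalFst a a₂₂ (fun t => -a₂₁ t) (fun t => -a₁₂ t) a₁₁ ψ φ) :
    IsMinimalSnd a a₁₁ a₁₂ a₂₁ a₂₂ (fun t => -φ t) ψ := by
  refine ⟨h.1.of_swap, ?_, fun φ' ψ' hsol hli => h.2.2 ψ' _ hsol.swap ?_⟩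
  · obtain ⟨t, ht, h⟩ := h.2.1
    exact ⟨t, ht, by simpa using h.symm⟩
  · simpa using hli.swap

/-- The assertions about the first component. -/
theorem exists_isMinimalFst (h₁₁ : ContinuousOn a₁₁ (Ici a)) (h₁₂ : ContinuousOn a₁₂ (Ici a))
    (h₂₁ : ContinuousOn a₂₁ (Ici a)) (h₂₂ : ContinuousOn a₂₂ (Ici a))
    (hsupp : ∀ T, a ≤ T → ∃ t, T ≤ t ∧ a₁₂ t ≠ 0)
    (hpos : ∀ t, a ≤ t → 0 ≤ a₁₂ t) (hneg : ∀ t, a ≤ t → a₂₁ t ≤ 0)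
    (hI₁₂ : ∃ L, Tendsto (IPlus a₁₂ (fun t => a₁₁ t - a₂₂ t) a) atTop (𝓝 L))
    (hI₂₁ : ∃ L, Tendsto (IPlus (fun t => -a₂₁ t) (fun t => a₂₂ t - a₁₁ t) a) atTop (𝓝 L)) :
    (∀ φ ψ, IsSolution a a₁₁ a₁₂ a₂₁ a₂₂ φ ψ → NontrivialPair a φ ψ → ¬ Oscillatory a φ) ∧
    ∃ φs ψ0, IsMinimalFst a a₁₁ a₁₂ a₂₁ a₂₂ φs ψ0 ∧
      (∃ T, a < T ∧ ∀ T', T ≤ T' → (∀ t, T' ≤ t → 0 < φs t ∧ ψ0 t < 0) ∧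
        ImproperEqTop (fun τ => a₁₂ τ * JExp (fun s => a₁₁ s + a₂₂ s) a τ / φs τ ^ 2) T' ∧
        ImproperEqBot (fun τ => a₁₂ τ * (ψ0 τ / φs τ)) T') ∧
      ∀ φ ψ, IsSolution a a₁₁ a₁₂ a₂₁ a₂₂ φ ψ → LinIndepPairs a φs ψ0 φ ψ →
        ∀ T₁, a ≤ T₁ → (∀ t, T₁ ≤ t → φ t ≠ 0) →
          ImproperConverges
            (fun τ => a₁₂ τ * JExp (fun s => a₁₁ s + a₂₂ s) a τ / φ τ ^ 2) T₁ ∧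
          ImproperConverges (fun τ => a₁₂ τ * (ψ τ / φ τ)) T₁ := by
  have hE := fun t => JExp_pos a₁₁ a t
  have hF := fun t => JExp_pos a₂₂ a t
  set p := reducedFst a a₁₁ a₁₂ a₂₂
  -- The same reduction with the indices exchanged: `q = -a₂₁ exp (∫ (a₁₁ - a₂₂))`.
  set q := reducedFst a a₂₂ (fun t => -a₂₁ t) a₁₁
  have hp : ContinuousOn p (Ici a) := continuousOn_reducedFst h₁₁ h₁₂ h₂₂
  have hq : ContinuousOn q (Ici a) := continuousOn_reducedFst h₂₂ h₂₁.neg h₁₁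
  have hp0 : ∀ t, a ≤ t → 0 ≤ p t := fun t ht => mul_nonneg (hpos t ht) (JExp_pos _ _ _).le
  have hq0 : ∀ t, a ≤ t → 0 ≤ q t := fun t ht =>
    mul_nonneg (neg_nonneg.2 (hneg t ht)) (JExp_pos _ _ _).le
  have hpi : IntegrableOn p (Ioi a) :=
    integrableOn_Ioi_of_tendsto_IPlus h₁₂ (h₁₁.sub h₂₂) hpos hI₁₂.choose_spec
  have hqi : IntegrableOn q (Ioi a) :=
    integrableOn_Ioi_of_tendsto_IPlus h₂₁.neg (h₂₂.sub h₁₁)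
      (fun t ht => neg_nonneg.2 (hneg t ht)) hI₂₁.choose_spec
  have hpsupp : ∀ T, a ≤ T → ∃ t, T ≤ t ∧ p t ≠ 0 := fun T hT =>
    (hsupp T hT).imp fun t ht => ⟨ht.1, mul_ne_zero ht.2 (JExp_pos _ _ _).ne'⟩
  refine ⟨fun φ ψ hsol hne hosc => ?_, ?_⟩
  · have hred := hsol.isOffDiagSolution h₁₁ h₂₂
    have hne' : NontrivialPair a (fun t => φ t / JExp a₁₁ a t) (fun t => ψ t / JExp a₂₂ a t) :=
      hne.imp fun t ht => ⟨ht.1, ht.2.imp (fun h => div_ne_zero h (hE t).ne')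
        (fun h => div_ne_zero h (hF t).ne')⟩
    obtain ⟨T, hT⟩ := eventually_atTop.1
      (hred.eventually_fst_ne_zero hp hq hp0 hq0 hpi hqi hpsupp hne')
    obtain ⟨t, ht, h0⟩ := hosc (max a T) (le_max_left _ _)
    exact hT t ((le_max_right _ _).trans ht) (by simp [h0])
  obtain ⟨us, vs, hs, hus, hvs⟩ :=
    exists_isOffDiagSolution_tendsto hp hq hp0 hq0 hpi hqi 0 (-1)
  obtain ⟨T, haT, hT⟩ := hs.eventually_signs hp0 hpsupp hus (by norm_num) hvs
  have eus : ∀ t, JExp a₁₁ a t * us t / JExp a₁₁ a t = us t := fun t =>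
    mul_div_cancel_left₀ _ (hE t).ne'
  have evs : ∀ t, JExp a₂₂ a t * vs t / JExp a₂₂ a t = vs t := fun t =>
    mul_div_cancel_left₀ _ (hF t).ne'
  -- solutions independent of the minimal one have a nonzero limit
  have hlim : ∀ φ ψ, IsSolution a a₁₁ a₁₂ a₂₁ a₂₂ φ ψ →
      LinIndepPairs a (fun t => JExp a₁₁ a t * us t) (fun t => JExp a₂₂ a t * vs t) φ ψ →
      ∃ b, b ≠ 0 ∧ Tendsto (fun t => φ t / JExp a₁₁ a t) atTop (𝓝 b) := by
    intro φ ψ hsol hli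
    have hred := hsol.isOffDiagSolution h₁₁ h₂₂
    obtain ⟨b, c, hb, hc⟩ := hred.exists_tendsto hp hq hp0 hq0 hpi hqi
    refine ⟨b, ?_, hb⟩
    rintro rfl
    -- The limits are `(0, -1)` and `(0, c)`, so adding `c` times the minimal solution cancels both;
    -- the sum vanishes identically, contradicting independence.
    have hcomb := hs.linear_comb hred c 1
    have hz := fun t ht => hcomb.eq_zero_of_tendsto_zero hp hq hp0 hq0 hpi hqi (t := t)
      (by simpa using (hus.const_mul c).add (hb.const_mul 1))
      (by simpa using (hvs.const_mul c).add (hc.const_mul 1)) ht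
    refine one_ne_zero (hli c 1 fun t ht => ?_).2
    obtain ⟨z1, z2⟩ := hz t ht
    have hE' := (hE t).ne'
    have hF' := (hF t).ne'
    field_simp at z1 z2
    constructor <;> linarith
  refine ⟨fun t => JExp a₁₁ a t * us t, fun t => JExp a₂₂ a t * vs t,
    ⟨hs.isSolution h₁₁ h₂₂,
      ⟨T, haT.le, Or.inl (mul_ne_zero (hE T).ne' (hT T le_rfl).1.ne')⟩, fun φ ψ hsol hli => ?_⟩,
    ⟨T, haT, fun T' hT' => ⟨fun t ht => ⟨mul_pos (hE t) (hT t (hT'.trans ht)).1,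
      mul_neg_of_pos_of_neg (hF t) (hT t (hT'.trans ht)).2⟩, ?_, ?_⟩⟩,
    fun φ ψ hsol hli T₁ hT₁ hne => ?_⟩
  · obtain ⟨b, hb0, hb⟩ := hlim φ ψ hsol hli
    refine ⟨(hb.eventually_ne hb0).mono fun t ht h0 => ht (by simp [h0]), ?_⟩
    have := hus.div hb hb0
    rw [zero_div] at this
    refine this.congr fun t => ?_
    simp only [Pi.div_apply]
    rw [div_div_eq_mul_div, mul_comm]
  · have haT' := haT.le.trans hT'
    obtain ⟨C, hC⟩ := hs.exists_bound hp hq hp0 hq0 hpi hqi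
    have hC0 : 0 < C := (abs_pos.2 (hT T le_rfl).2.ne).trans_le (hC T haT.le)
    refine ((hs.restrict haT').improperEqTop_div_sq (hp.mono (Ici_subset_Ici.2 haT'))
      (fun t ht => hp0 t (haT'.trans ht)) (fun t ht => (hT t (hT'.trans ht)).1) hC0
      (fun t ht => hC t (haT'.trans ht)) hus).congr fun t ht => ?_
    have e := reducedFst_div_sq (a₁₂ := a₁₂) (φ := fun t => JExp a₁₁ a t * us t) h₁₁ h₂₂
      (haT'.trans ht)
    simp only [eus] at e
    exact e
  · have haT' := haT.le.trans hT'
    refine ((hs.restrict haT').improperEqBot_mul_div (hp.mono (Ici_subset_Ici.2 haT'))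
      (fun t ht => (hT t (hT'.trans ht)).1) hus).congr fun t ht => ?_
    have e := reducedFst_mul_div (a₁₂ := a₁₂) (φ := fun t => JExp a₁₁ a t * us t)
      (ψ := fun t => JExp a₂₂ a t * vs t) h₁₁ h₂₂ (haT'.trans ht)
    simp only [eus, evs] at e
    exact e
  · obtain ⟨b, hb0, hb⟩ := hlim φ ψ hsol hli
    have hred := (hsol.isOffDiagSolution h₁₁ h₂₂).restrict hT₁
    have hp' : ContinuousOn p (Ici T₁) := hp.mono (Ici_subset_Ici.2 hT₁)
    have hne' : ∀ t, T₁ ≤ t → φ t / JExp a₁₁ a t ≠ 0 := fun t ht =>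
      div_ne_zero (hne t ht) (hE t).ne'
    exact ⟨(hred.improperConverges_div_sq hp' (hpi.mono_set (Ioi_subset_Ioi hT₁)) hne' hb0
        hb).congr fun t ht => reducedFst_div_sq h₁₁ h₂₂ (hT₁.trans ht),
      (hred.improperConverges_mul_div hp' hne' hb0 hb).congr fun t ht =>
        reducedFst_mul_div h₁₁ h₂₂ (hT₁.trans ht)⟩

end System

/-! ### Assembly of the two components. -/

theorem theorem3p11 (t₀ : ℝ) (a₁₁ a₁₂ a₂₁ a₂₂ : ℝ → ℝ)
    (h₁₁ : ContinuousOn a₁₁ (Ici t₀)) (h₁₂ : ContinuousOn a₁₂ (Ici t₀))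
    (h₂₁ : ContinuousOn a₂₁ (Ici t₀)) (h₂₂ : ContinuousOn a₂₂ (Ici t₀))
    -- the supports of `a₁₂` and `a₂₁` are unbounded
    (hsupp₁₂ : ∀ T : ℝ, t₀ ≤ T → ∃ t : ℝ, T ≤ t ∧ a₁₂ t ≠ 0)
    (hsupp₂₁ : ∀ T : ℝ, t₀ ≤ T → ∃ t : ℝ, T ≤ t ∧ a₂₁ t ≠ 0)
    (hpos : ∀ t : ℝ, t₀ ≤ t → 0 ≤ a₁₂ t) (hneg : ∀ t : ℝ, t₀ ≤ t → a₂₁ t ≤ 0)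
    -- `I⁺_{a₁₂,B}(t₀) < ∞` and `I⁺_{-a₂₁,-B}(t₀) < ∞`, where `B = a₁₁ - a₂₂`
    (hI₁₂ : ∃ L : ℝ, Tendsto (IPlus a₁₂ (fun t => a₁₁ t - a₂₂ t) t₀) atTop (𝓝 L))
    (hI₂₁ : ∃ L : ℝ,
      Tendsto (IPlus (fun t => - a₂₁ t) (fun t => - (a₁₁ t - a₂₂ t)) t₀) atTop (𝓝 L)) :
    NonOscillatorySystem t₀ a₁₁ a₁₂ a₂₁ a₂₂ ∧
    ∃ φs ψ0 φ0 ψs : ℝ → ℝ,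
      -- `(φs, ψ0)` and `(φ0, ψs)` are independent minimal solutions
      IsMinimalFst t₀ a₁₁ a₁₂ a₂₁ a₂₂ φs ψ0 ∧
      IsMinimalSnd t₀ a₁₁ a₁₂ a₂₁ a₂₂ φ0 ψs ∧
      LinIndepPairs t₀ φs ψ0 φ0 ψs ∧
      -- each of them is unique up to a multiplier
      (∀ φ ψ : ℝ → ℝ, IsMinimalFst t₀ a₁₁ a₁₂ a₂₁ a₂₂ φ ψ →
        ∃ c : ℝ, c ≠ 0 ∧ ∀ t : ℝ, t₀ ≤ t → φ t = c * φs t ∧ ψ t = c * ψ0 t) ∧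
      (∀ φ ψ : ℝ → ℝ, IsMinimalSnd t₀ a₁₁ a₁₂ a₂₁ a₂₂ φ ψ →
        ∃ c : ℝ, c ≠ 0 ∧ ∀ t : ℝ, t₀ ≤ t → φ t = c * φ0 t ∧ ψ t = c * ψs t) ∧
      -- signs, and the divergent integrals along the minimal solutions
      (∃ T : ℝ, t₀ < T ∧
        (∀ t : ℝ, T ≤ t → 0 < φs t ∧ ψ0 t < 0 ∧ 0 < φ0 t ∧ 0 < ψs t) ∧
        ImproperEqTop (fun τ => a₁₂ τ * JExp (fun s => a₁₁ s + a₂₂ s) t₀ τ / φs τ ^ 2) T ∧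
        ImproperEqBot (fun τ => a₂₁ τ * JExp (fun s => a₁₁ s + a₂₂ s) t₀ τ / ψs τ ^ 2) T ∧
        ImproperEqBot (fun τ => a₁₂ τ * (ψ0 τ / φs τ)) T ∧
        ImproperEqBot (fun τ => a₂₁ τ * (φ0 τ / ψs τ)) T) ∧
      -- the convergent integrals along all the other solutions
      (∀ φ ψ : ℝ → ℝ, IsSolution t₀ a₁₁ a₁₂ a₂₁ a₂₂ φ ψ → LinIndepPairs t₀ φs ψ0 φ ψ →
        ∀ T₁ : ℝ, t₀ ≤ T₁ → (∀ t : ℝ, T₁ ≤ t → φ t ≠ 0 ∧ ψ t ≠ 0) →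
          ImproperConverges
            (fun τ => a₁₂ τ * JExp (fun s => a₁₁ s + a₂₂ s) t₀ τ / φ τ ^ 2) T₁ ∧
          ImproperConverges (fun τ => a₁₂ τ * (ψ τ / φ τ)) T₁) ∧
      (∀ φ ψ : ℝ → ℝ, IsSolution t₀ a₁₁ a₁₂ a₂₁ a₂₂ φ ψ → LinIndepPairs t₀ φ0 ψs φ ψ →
        ∀ T₁ : ℝ, t₀ ≤ T₁ → (∀ t : ℝ, T₁ ≤ t → φ t ≠ 0 ∧ ψ t ≠ 0) →
          ImproperConverges
            (fun τ => |a₂₁ τ| * JExp (fun s => a₁₁ s + a₂₂ s) t₀ τ / ψ τ ^ 2) T₁ ∧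
          ImproperConverges (fun τ => a₂₁ τ * (φ τ / ψ τ)) T₁) := by
  have hI₂₁' : ∃ L, Tendsto (IPlus (fun t => -a₂₁ t) (fun t => a₂₂ t - a₁₁ t) t₀) atTop (𝓝 L) := by
    simpa only [neg_sub] using hI₂₁
  obtain ⟨hosc₁, φs, ψ0, hmin₁, ⟨T, hT, hTs⟩, hconv₁⟩ :=
    exists_isMinimalFst h₁₁ h₁₂ h₂₁ h₂₂ hsupp₁₂ hpos hneg hI₁₂ hI₂₁'
  -- The first-component result for the rotated system, with `χ = -φ0`.
  obtain ⟨hosc₂, ψs, χ, hmin₂, ⟨T', -, hTs'⟩, hconv₂⟩ :=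
    exists_isMinimalFst (a₁₂ := fun t => -a₂₁ t) (a₂₁ := fun t => -a₁₂ t) h₂₂ h₂₁.neg h₁₂.neg h₁₁
      (fun T hT => (hsupp₂₁ T hT).imp fun t ht => ⟨ht.1, neg_ne_zero.2 ht.2⟩)
      (fun t ht => neg_nonneg.2 (hneg t ht)) (fun t ht => neg_nonpos.2 (hpos t ht)) hI₂₁'
      (by simpa only [neg_neg] using hI₁₂)
  simp only [add_comm (a₂₂ _)] at hTs' hconv₂
  obtain ⟨sgn₁, top₁, bot₁⟩ := hTs (max T T') (le_max_left _ _)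
  obtain ⟨sgn₂, top₂, bot₂⟩ := hTs' (max T T') (le_max_right _ _)
  have hmin₂' := hmin₂.of_swap
  refine ⟨fun φ ψ hsol hne => ⟨hosc₁ φ ψ hsol hne, hosc₂ ψ _ hsol.swap hne.swap⟩,
    φs, ψ0, fun t => -χ t, ψs, hmin₁, hmin₂', ?_, fun φ ψ h => hmin₁.unique h, ?_,
    ⟨max T T', hT.trans_le (le_max_left _ _), fun t ht => ⟨(sgn₁ t ht).1, (sgn₁ t ht).2,
      neg_pos.2 (sgn₂ t ht).2, (sgn₂ t ht).1⟩, top₁, ?_, bot₁, ?_⟩,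
    fun φ ψ hsol hli T₁ hT₁ hne => hconv₁ φ ψ hsol hli T₁ hT₁ fun t ht => (hne t ht).1,
    fun φ ψ hsol hli T₁ hT₁ hne => ?_⟩
  · intro c₁ c₂ hc
    have ht₀ : t₀ ≤ max T T' := hT.le.trans (le_max_left _ _)
    obtain ⟨e1, e2⟩ := hc _ ht₀
    obtain ⟨s1, s2⟩ := sgn₁ _ le_rfl
    obtain ⟨s3, s4⟩ := sgn₂ _ le_rfl
    generalize max T T' = x at *
    -- The sign pattern alone makes the determinant of the two solutions at `x` positive, which
    -- gives independence.
    have hdet : 0 < φs x * ψs x + χ x * ψ0 x := add_pos (mul_pos s1 s3) (mul_pos_of_neg_of_neg s4 s2)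
    constructor
    · refine (mul_eq_zero.1 ?_).resolve_right hdet.ne'
      linear_combination ψs x * e1 + χ x * e2
    · refine (mul_eq_zero.1 ?_).resolve_right hdet.ne'
      linear_combination φs x * e2 - ψ0 x * e1
  · intro φ ψ h
    obtain ⟨c, hc, hcs⟩ := hmin₂'.swap.unique h.swap
    exact ⟨c, hc, fun t ht => ⟨by linarith [(hcs t ht).2], (hcs t ht).1⟩⟩
  · exact top₂.neg.congr fun t _ => by ring
  · exact bot₂.congr fun t _ => by ring
  · obtain ⟨c1, c2⟩ := hconv₂ ψ _ hsol.swap (by simpa using hli.swap) T₁ hT₁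
      fun t ht => (hne t ht).2
    refine ⟨c1.congr fun t ht => ?_, c2.congr fun t _ => by ring⟩
    rw [abs_of_nonpos (hneg t (hT₁.trans ht))]
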